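/- Fix a countably infinite set $\mathbb{A}$ of atoms and let $\mathfrak{S}_f(\mathbb{A})$ be the group of finite permutations of $\mathbb{A}$ (those moving only finitely many atoms). A set $S\subseteq\mathbb{A}$ supports an element $x$ of an $\mathfrak{S}_f(\mathbb{A})$-set if $\pi\cdot x=x$ for every $\pi\in\mathfrak{S}_f(\mathbb{A})$ with $\pi(a)=a$ for all $a\in S$. A nominal set is an $\mathfrak{S}_f(\mathbb{A})$-set $X$ in which every element $x$ is supported by some finite set; $\mathrm{supp}(x)$ denotes the least such set. Let $\mathsf{Nom}$ be the category of nominal sets and equivariant maps. A nominal set $X$ is strong if for all $x\in X$ and $\pi\in\mathfrak{S}_f(\mathbb{A})$ with $\pi\cdot x=x$ we have $\pi(a)=a$ for all $a\in\mathrm{supp}(x)$. The binding functor $[\mathbb{A}]\colon\mathsf{Nom}\to\mathsf{Nom}$ sends $X$ to $(\mathbb{A}\times X)/{\sim_\alpha}$, where $(a,x)\sim_\alpha(b,y)$ iff $(a\,c)\cdot x=(b\,c)\cdot y$ for some atom $c\notin\mathrm{supp}(x)\cup\mathrm{supp}(y)$, with the action induced from $\mathbb{A}\times X$, and sends an equivariant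 map $f$ to the map $[(a,x)]_{\sim_\alpha}\mapsto[(a,f(x))]_{\sim_\alpha}$. Let $F\colon\mathcal{C}\to\mathcal{C}$ be a functor and $\mathcal{S}$ a class of objects of $\mathcal{C}$ closed under isomorphism. A morphism $s\colon S\to FR$ is $F$-precise if for all $f\colon S\to FC$, $g\colon R\to D$, $h\colon C\to D$ with $Fg\cdot s=Fh\cdot f$ there is $d\colon R\to C$ with $Fd\cdot s=f$ and $h\cdot d=g$. The functor $F$ admits precise factorizations w.r.t. $\mathcal{S}$ if for every $f\colon S\to FY$ with $S\in\mathcal{S}$ there exist $Y'\in\mathcal{S}$, a morphism $h\colon Y'\to Y$ and an $F$-precise $f'\colon S\to FY'$ with $Fh\cdot f'=f$. **Proposition.** The binding functor $[\mathbb{A}]$ on $\mathsf{Nom}$ admits precise factorizations w.r.t. the class of strong nominal sets, and so does the functor $FX=\{\checkmark\}+[\mathbb{A}]X+\mathbb{A}\times X$ (where $\{\checkmark\}$ carries the trivial action and $+$, $\times$ are the coproduct and product of nominal sets). -/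

import Mathlib

open CategoryTheory

universe v u

/-! ### Precise morphisms and precise factorizations in an arbitrary category -/

/-- A morphism `s : S ⟶ F R` is `F`-precise if every commuting square
`s ≫ F g = f ≫ F h` (with `g : R ⟶ D`, `f : S ⟶ F C`, `h : C ⟶ D`) admits some `d : R ⟶ C` with
`s ≫ F d = f` and `d ≫ h = g`. -/
def IsPrecise {C : Type u} [Category.{v} C] (F : C ⥤ C) {S R : C} (s : S ⟶ F.obj R) : Prop :=
  ∀ ⦃X D : C⦄ (f : S ⟶ F.obj X) (g : R ⟶ D) (h : X ⟶ D),
    s ≫ F.map g = f ≫ F.map h → ∃ d : R ⟶ X, s ≫ F.map d = f ∧ d ≫ h = g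

/-- `F` admits precise factorizations with respect to the (isomorphism-closed) class `P` of
objects: each `f : S ⟶ F Y` with `S` in `P` is `f' ≫ F h` with `f' : S ⟶ F Y'` an `F`-precise
morphism, `Y'` in `P`, and `h : Y' ⟶ Y`. -/
def AdmitsPreciseFactorizations {C : Type u} [Category.{v} C] (F : C ⥤ C)
    (P : ObjectProperty C) [P.IsClosedUnderIsomorphisms] : Prop :=
  ∀ ⦃S Y : C⦄ (f : S ⟶ F.obj Y), P S →
    ∃ (Y' : C) (_ : P Y') (h : Y' ⟶ Y) (f' : S ⟶ F.obj Y'),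
      IsPrecise F f' ∧ f' ≫ F.map h = f

/-! ### Finite permutations of atoms -/

/-- The group of finite permutations of `A`: those that move only finitely many elements. -/
def FinPerm (A : Type u) : Subgroup (Equiv.Perm A) where
  carrier := {π | {a | π a ≠ a}.Finite}
  one_mem' := by simp
  mul_mem' := by
    intro π σ hπ hσ
    refine (hπ.union hσ).subset ?_
    intro a ha
    by_contra hn
    simp only [Set.mem_union, Set.mem_ofPred_eq, not_or, not_not] at hn
    exact ha (by rw [Equiv.Perm.mul_apply, hn.2, hn.1])
  inv_mem' := by
    intro π hπ
    refine Set.Finite.subset hπ ?_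
    intro a ha h
    exact ha (by rw [Equiv.Perm.inv_eq_iff_eq, h])

namespace FinPerm

variable {A : Type u}

/-- The transposition `(a b)`. -/
noncomputable def swap (a b : A) : FinPerm A :=
  ⟨@Equiv.swap A (Classical.decEq A) a b, by
    refine Set.Finite.subset (Set.toFinite {a, b}) ?_
    intro x hx
    by_contra hn
    simp only [Set.mem_insert_iff, Set.mem_singleton_iff, not_or] at hn
    exact hx (@Equiv.swap_apply_of_ne_of_ne A (Classical.decEq A) a b x hn.1 hn.2)⟩

theorem smul_def (π : FinPerm A) (a : A) : π • a = (π : Equiv.Perm A) a := rfl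

theorem swap_self (a : A) : swap a a = 1 :=
  Subtype.ext (@Equiv.swap_self A (Classical.decEq A) a)

theorem swap_comm (a b : A) : swap a b = swap b a :=
  Subtype.ext (@Equiv.swap_comm A (Classical.decEq A) a b)

theorem swap_mul_self (a b : A) : swap a b * swap a b = 1 :=
  Subtype.ext (@Equiv.swap_mul_self A (Classical.decEq A) a b)

theorem swap_smul_of_ne {a b c : A} (ha : c ≠ a) (hb : c ≠ b) : swap a b • c = c :=
  @Equiv.swap_apply_of_ne_of_ne A (Classical.decEq A) a b c ha hb

theorem swap_smul_left (a b : A) : swap a b • a = b :=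
  @Equiv.swap_apply_left A (Classical.decEq A) a b

theorem swap_smul_right (a b : A) : swap a b • b = a :=
  @Equiv.swap_apply_right A (Classical.decEq A) a b

theorem mul_swap (π : FinPerm A) (a b : A) :
    π * swap a b = swap (π • a) (π • b) * π :=
  Subtype.ext (@Equiv.mul_swap_eq_swap_mul A (Classical.decEq A) π a b)

end FinPerm

/-! ### Nominal sets -/

/-- The support of `x`: the least finite set of atoms supporting `x`, i.e. the intersection of all
finite sets supporting `x`. -/
def supp (A : Type u) {X : Type u} [MulAction (FinPerm A) X] (x : X) : Set A :=
  {a | ∀ s : Set A, s.Finite → MulAction.Supports (FinPerm A) s x → a ∈ s}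

/-- Nominal sets over the set of atoms `A`: sets with an action of the finite permutations such
that every element is finitely supported. -/
structure Nom (A : Type u) where
  carrier : Type u
  [action : MulAction (FinPerm A) carrier]
  finitely_supported : ∀ x : carrier,
    ∃ s : Set A, s.Finite ∧ MulAction.Supports (FinPerm A) s x

namespace Nom

variable {A : Type u}

instance : CoeSort (Nom A) (Type u) := ⟨carrier⟩

attribute [instance] action

/-- The category of nominal sets and equivariant maps. -/
instance : Category (Nom A) where
  Hom X Y := X →[FinPerm A] Y
  id X := MulActionHom.id (FinPerm A)
  comp f g := MulActionHom.comp g f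

/-- A nominal set is strong if each permutation fixing an element `x` fixes every atom in the
support of `x`. -/
def IsStrong : ObjectProperty (Nom A) := fun X =>
  ∀ (x : X) (π : FinPerm A), π • x = x → ∀ a ∈ supp A x, π • a = a

theorem supports_map {X Y : Type u} [MulAction (FinPerm A) X] [MulAction (FinPerm A) Y]
    (f : X →[FinPerm A] Y) {s : Set A} {x : X} (h : MulAction.Supports (FinPerm A) s x) :
    MulAction.Supports (FinPerm A) s (f x) := by
  intro π hπ
  rw [← map_smul, h π hπ]

theorem supp_map_subset {X Y : Type u} [MulAction (FinPerm A) X] [MulAction (FinPerm A) Y]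
    (f : X →[FinPerm A] Y) (x : X) : supp A (f x) ⊆ supp A x :=
  fun _ ha s hs hx => ha s hs (supports_map f hx)

instance : (IsStrong (A := A)).IsClosedUnderIsomorphisms where
  of_iso {X Y} e hX := by
    intro y π hy a ha
    have hinv : ∀ y : Y, e.hom.toFun (e.inv.toFun y) = y := fun y =>
      congrArg (fun k : Y →[FinPerm A] Y => k y) e.inv_hom_id
    refine hX (e.inv.toFun y) π ?_ a ?_
    · rw [← show e.inv.toFun (π • y) = π • e.inv.toFun y from e.inv.map_smul' π y, hy]
    · have := supp_map_subset (A := A) (X := X) (Y := Y) e.hom (e.inv.toFun y)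
      apply this
      change a ∈ supp A (e.hom.toFun (e.inv.toFun y))
      rwa [hinv]

/-! ### The binding functor -/

theorem notMem_supp {X : Type u} [MulAction (FinPerm A) X] {x : X} {c : A} :
    c ∉ supp A x ↔ ∃ s : Set A, s.Finite ∧ MulAction.Supports (FinPerm A) s x ∧ c ∉ s := by
  simp [supp]

theorem supports_smul {X : Type u} [MulAction (FinPerm A) X] {x : X} {s : Set A}
    (π : FinPerm A) (h : MulAction.Supports (FinPerm A) s x) :
    MulAction.Supports (FinPerm A) ((fun a => π • a) '' s) (π • x) := by
  intro σ hσ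
  have : (π⁻¹ * σ * π) • x = x := by
    refine h _ fun a ha => ?_
    rw [mul_smul, mul_smul, hσ (Set.mem_image_of_mem _ ha), inv_smul_smul]
  rw [mul_smul, mul_smul, inv_smul_eq_iff] at this
  exact this

theorem smul_notMem_supp {X : Type u} [MulAction (FinPerm A) X] {x : X} {c : A}
    (π : FinPerm A) (h : c ∉ supp A x) : π • c ∉ supp A (π • x) := by
  obtain ⟨s, hs, hx, hc⟩ := notMem_supp.1 h
  refine notMem_supp.2 ⟨_, hs.image _, supports_smul π hx, ?_⟩
  rintro ⟨d, hd, hdc⟩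
  exact hc ((MulAction.injective π hdc) ▸ hd)

/-- α-equivalence on `A × X`: `(a, x) ∼ (b, y)` iff `(a c) • x = (b c) • y` for some atom `c`
outside `supp x` and `supp y`. -/
def AlphaEquiv (X : Nom A) (p q : A × X) : Prop :=
  ∃ c : A, c ∉ supp A p.2 ∧ c ∉ supp A q.2 ∧
    FinPerm.swap p.1 c • p.2 = FinPerm.swap q.1 c • q.2

theorem finite_supp (X : Nom A) (x : X) : (supp A x).Finite := by
  obtain ⟨s, hs, hx⟩ := X.finitely_supported x
  exact hs.subset fun _ ha => ha s hs hx

theorem AlphaEquiv.smul {X : Nom A} {p q : A × X} (π : FinPerm A) (h : AlphaEquiv X p q) :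
    AlphaEquiv X (π • p) (π • q) := by
  obtain ⟨c, hp, hq, h⟩ := h
  refine ⟨π • c, smul_notMem_supp π hp, smul_notMem_supp π hq, ?_⟩
  simp only [Prod.smul_fst, Prod.smul_snd]
  rw [← mul_smul, ← FinPerm.mul_swap, mul_smul, h, ← mul_smul, FinPerm.mul_swap, mul_smul]

theorem AlphaEquiv.map {X Y : Nom A} (f : X →[FinPerm A] Y) {p q : A × X}
    (h : AlphaEquiv X p q) : AlphaEquiv Y (p.1, f p.2) (q.1, f q.2) := by
  obtain ⟨c, hp, hq, h⟩ := h
  refine ⟨c, fun hc => hp (supp_map_subset f _ hc), fun hc => hq (supp_map_subset f _ hc), ?_⟩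
  simp only
  rw [← map_smul, h, map_smul]

variable [Infinite A]

theorem swap_smul_of_notMem_supp {X : Type u} [MulAction (FinPerm A) X] {x : X} {c d : A}
    (hc : c ∉ supp A x) (hd : d ∉ supp A x) : FinPerm.swap c d • x = x := by
  obtain ⟨s, hs, hsx, hcs⟩ := notMem_supp.1 hc
  obtain ⟨t, ht, htx, hdt⟩ := notMem_supp.1 hd
  obtain ⟨e, he⟩ := ((hs.union ht).union (Set.toFinite {c, d})).infinite_compl.nonempty
  simp only [Set.mem_compl_iff, Set.mem_union, Set.mem_insert_iff, Set.mem_singleton_iff,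
    not_or] at he
  obtain ⟨⟨hes, het⟩, hec, hed⟩ := he
  have h1 : FinPerm.swap c e • x = x := hsx _ fun a ha =>
    FinPerm.swap_smul_of_ne (fun h => hcs (h ▸ ha)) (fun h => hes (h ▸ ha))
  have h2 : FinPerm.swap d e • x = x := htx _ fun a ha =>
    FinPerm.swap_smul_of_ne (fun h => hdt (h ▸ ha)) (fun h => het (h ▸ ha))
  by_cases hcd : c = d
  · rw [hcd, FinPerm.swap_self, one_smul]
  have h3 := FinPerm.mul_swap (FinPerm.swap c e) d e
  rw [FinPerm.swap_smul_of_ne (Ne.symm hcd) (Ne.symm hed), FinPerm.swap_smul_right] at h3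
  have h4 : (FinPerm.swap d c * FinPerm.swap c e) • x = x := by
    rw [← h3, mul_smul, h2, h1]
  rw [mul_smul, h1] at h4
  rw [FinPerm.swap_comm, h4]

/-- The atoms in the equation `(a c) • x = (b c) • y` may be exchanged for any other fresh atom. -/
theorem swap_smul_change {X : Type u} [MulAction (FinPerm A) X] {x : X} {a c e : A}
    (hc : c ∉ supp A x) (he : e ∉ supp A x) :
    FinPerm.swap c e • FinPerm.swap a c • x = FinPerm.swap a e • x := by
  by_cases hca : c = a
  · subst hca; rw [FinPerm.swap_self, one_smul]
  by_cases hea : e = a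
  · subst hea
    rw [FinPerm.swap_self, one_smul, FinPerm.swap_comm c e, ← mul_smul, FinPerm.swap_mul_self,
      one_smul]
  rw [← mul_smul, FinPerm.mul_swap, mul_smul, swap_smul_of_notMem_supp hc he,
    FinPerm.swap_smul_of_ne (Ne.symm hca) (Ne.symm hea), FinPerm.swap_smul_left]

theorem alphaEquiv_equivalence (X : Nom A) : Equivalence (AlphaEquiv X) where
  refl p := by
    obtain ⟨c, hc⟩ := (finite_supp X p.2).infinite_compl.nonempty
    exact ⟨c, hc, hc, rfl⟩
  symm := fun ⟨c, h1, h2, h⟩ => ⟨c, h2, h1, h.symm⟩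
  trans := by
    rintro ⟨a, x⟩ ⟨b, y⟩ ⟨d, z⟩ ⟨c, hcx, hcy, h⟩ ⟨c', hcy', hcz', h'⟩
    obtain ⟨e, he⟩ := (((finite_supp X x).union (finite_supp X y)).union
      (finite_supp X z)).infinite_compl.nonempty
    simp only [Set.mem_compl_iff, Set.mem_union, not_or] at he
    obtain ⟨⟨hex, hey⟩, hez⟩ := he
    refine ⟨e, hex, hez, ?_⟩
    dsimp only at *
    rw [← swap_smul_change hcx hex, h, swap_smul_change hcy hey, ← swap_smul_change hcy' hey, h',
      swap_smul_change hcz' hez]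

/-- α-equivalence as a setoid. -/
def alphaSetoid (X : Nom A) : Setoid (A × X) := ⟨AlphaEquiv X, alphaEquiv_equivalence X⟩

/-- The underlying set of `[A]X`: the quotient of `A × X` by α-equivalence. -/
def Abstraction (X : Nom A) : Type u := Quotient (alphaSetoid X)

/-- The α-equivalence class of `(a, x)`. -/
def Abstraction.mk {X : Nom A} (a : A) (x : X) : Abstraction X :=
  Quotient.mk (alphaSetoid X) (a, x)

/-- The action on `[A]X` is induced by the one on `A × X`: `π • ⟨a⟩x = ⟨π • a⟩(π • x)`. -/
instance (X : Nom A) : MulAction (FinPerm A) (Abstraction X) where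
  smul π := Quotient.map (sa := alphaSetoid X) (sb := alphaSetoid X) (fun p => π • p)
    fun _ _ h => AlphaEquiv.smul π h
  one_smul := by
    rintro ⟨p⟩
    exact congrArg (Quotient.mk (alphaSetoid X)) (one_smul _ p)
  mul_smul := by
    rintro π σ ⟨p⟩
    exact congrArg (Quotient.mk (alphaSetoid X)) (mul_smul π σ p)

theorem Abstraction.smul_mk {X : Nom A} (π : FinPerm A) (a : A) (x : X) :
    π • Abstraction.mk a x = Abstraction.mk (π • a) (π • x) := rfl

/-- The binding functor `[A]` on nominal sets; on morphisms, `⟨a⟩x ↦ ⟨a⟩(f x)`. -/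
def binding (A : Type u) [Infinite A] : Nom A ⥤ Nom A where
  obj X :=
    { carrier := Abstraction X
      finitely_supported := by
        rintro ⟨⟨a, x⟩⟩
        obtain ⟨s, hs, hx⟩ := X.finitely_supported x
        refine ⟨insert a s, hs.insert a, fun π hπ => ?_⟩
        change π • Abstraction.mk a x = Abstraction.mk a x
        rw [Abstraction.smul_mk, hπ (Set.mem_insert a s),
          hx π fun b hb => hπ (Set.mem_insert_of_mem a hb)] }
  map {X Y} f :=
    { toFun := Quotient.map (sa := alphaSetoid X) (sb := alphaSetoid Y)
        (fun p => (p.1, f.toFun p.2)) fun _ _ h => AlphaEquiv.map f h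
      map_smul' := by
        rintro π ⟨⟨a, x⟩⟩
        exact congrArg (fun y => Abstraction.mk (π • a) y) (f.map_smul' π x) }
  map_id X := by
    apply MulActionHom.ext
    rintro ⟨p⟩
    rfl
  map_comp f g := by
    apply MulActionHom.ext
    rintro ⟨p⟩
    rfl

/-! ### The functor `F X = {✓} + [A]X + A × X` -/

/-- The functor `F X = {✓} + ([A]X + A × X)` on nominal sets, with the trivial action on
`{✓}`, the evident actions on coproducts and products, and `F f = id + ([A]f + id × f)`. -/
def rnnaFunctor (A : Type u) [Infinite A] : Nom A ⥤ Nom A where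
  obj X :=
    { carrier := PUnit.{u + 1} ⊕ ((binding A).obj X ⊕ A × X)
      finitely_supported := by
        rintro (x | p | ⟨a, x⟩)
        · exact ⟨∅, Set.finite_empty, fun _ _ => rfl⟩
        · obtain ⟨s, hs, hp⟩ := ((binding A).obj X).finitely_supported p
          exact ⟨s, hs, fun π hπ => congrArg (fun q => Sum.inr (Sum.inl q)) (hp π hπ)⟩
        · obtain ⟨s, hs, hx⟩ := X.finitely_supported x
          refine ⟨insert a s, hs.insert a, fun π hπ => ?_⟩
          exact congrArg (fun q => Sum.inr (Sum.inr q)) (Prod.ext (hπ (Set.mem_insert a s))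
            (hx π fun b hb => hπ (Set.mem_insert_of_mem a hb))) }
  map {X Y} f :=
    { toFun := Sum.map id (Sum.map ((binding A).map f).toFun (Prod.map id f.toFun))
      map_smul' := by
        rintro π (x | p | ⟨a, x⟩)
        · rfl
        · exact congrArg (fun q => Sum.inr (Sum.inl q)) (((binding A).map f).map_smul' π p)
        · exact congrArg (fun y => Sum.inr (Sum.inr (π • a, y))) (f.map_smul' π x) }
  map_id X := by
    apply MulActionHom.ext
    rintro (x | p | ⟨a, x⟩)
    · rfl
    · exact congrArg (fun k : (binding A).obj X →[FinPerm A] (binding A).obj X =>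
        Sum.inr (Sum.inl (k p))) ((binding A).map_id X)
    · rfl
  map_comp {X Y Z} f g := by
    apply MulActionHom.ext
    rintro (x | p | ⟨a, x⟩)
    · rfl
    · exact congrArg (fun k : (binding A).obj X →[FinPerm A] (binding A).obj Z =>
        Sum.inr (Sum.inl (k p))) ((binding A).map_comp f g)
    · rfl

end Nom

/-!
The binding functor has a left adjoint, the separated product `S ↦ S * A` of pairs `(s, b)` with
`b` fresh for `s`: an element `q` of `[A]X` has exactly one representative `⟨b⟩x` for each atom `b`
fresh for `q` (`Nom.Abstraction.exists_mk_eq` and `Nom.Abstraction.mk_injective`), so an equivariant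
map `f : S → [A]X` is the same thing as the equivariant map `S * A → X` sending `(s, b)` to the `x`
with `f s = ⟨b⟩x` (`Nom.transpose`). Hence every `f : S → [A]Y` factors through the unit
`S → [A](S * A)`, `s ↦ ⟨b⟩(s, b)`, and the universal property makes the unit precise. Since a
permutation fixing `(s, b)` fixes both `s` and `b`, the nominal set `S * A` is strong if `S` is.

The constant functor at `{✓}` and `A × -` admit precise factorizations by taking `Y'` to be the
empty nominal set and `S` respectively. Finally the property passes to pointwise coproducts of
functors (`Nom.admitsPreciseFactorizations_sum`): a map `S → FY + GY` splits `S` into the parts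
mapped to the left and to the right, and the factorizations of the two restrictions are glued.
-/

namespace Nom

variable {A : Type u}

/-! ### Equivariant maps and strong nominal sets -/

theorem hom_comp_apply {X Y Z : Nom A} (f : X ⟶ Y) (g : Y ⟶ Z) (x : X) :
    (f ≫ g).toFun x = g.toFun (f.toFun x) := rfl

theorem hom_ext {X Y : Nom A} {f g : X ⟶ Y} (h : ∀ x, f.toFun x = g.toFun x) : f = g :=
  MulActionHom.ext h

theorem hom_congr {X Y : Nom A} {f g : X ⟶ Y} (h : f = g) (x : X) : f.toFun x = g.toFun x := by
  rw [h]

theorem hom_smul {X Y : Nom A} (f : X ⟶ Y) (π : FinPerm A) (x : X) :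
    f.toFun (π • x) = π • f.toFun x := f.map_smul' π x

/-- The equivariant map whose graph is a given equivariant functional relation. -/
noncomputable def homOfExistsUnique {X Y : Nom A} (R : X → Y → Prop)
    (hR : ∀ (π : FinPerm A) x y, R x y → R (π • x) (π • y)) (h : ∀ x, ∃! y, R x y) : X ⟶ Y where
  toFun x := (h x).choose
  map_smul' π x := (h (π • x)).unique (h _).choose_spec.1 (hR π _ _ (h x).choose_spec.1)

theorem homOfExistsUnique_spec {X Y : Nom A} (R : X → Y → Prop)
    (hR : ∀ (π : FinPerm A) x y, R x y → R (π • x) (π • y)) (h : ∀ x, ∃! y, R x y) (x : X) :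
    R x ((homOfExistsUnique R hR h).toFun x) := (h x).choose_spec.1

theorem IsStrong.of_injective {X Y : Nom A} (i : X ⟶ Y) (hi : Function.Injective i.toFun)
    (hY : IsStrong Y) : IsStrong X := by
  intro x π hπ a ha
  refine hY (i.toFun x) π (by rw [← hom_smul, hπ]) a fun s hs hsx => ha s hs fun σ hσ => ?_
  apply hi
  rw [hom_smul, hsx σ hσ]

/-! ### Coproducts and summands -/

/-- The coproduct of two nominal sets. -/
def sum (X Y : Nom A) : Nom A where
  carrier := X ⊕ Y
  finitely_supported := by
    rintro (x | y)
    · obtain ⟨s, hs, hx⟩ := X.finitely_supported x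
      exact ⟨s, hs, fun π hπ => congrArg Sum.inl (hx π hπ)⟩
    · obtain ⟨s, hs, hy⟩ := Y.finitely_supported y
      exact ⟨s, hs, fun π hπ => congrArg Sum.inr (hy π hπ)⟩

/-- The left coproduct injection. -/
def sumInl (X Y : Nom A) : X ⟶ sum X Y where
  toFun := Sum.inl
  map_smul' _ _ := rfl

/-- The right coproduct injection. -/
def sumInr (X Y : Nom A) : Y ⟶ sum X Y where
  toFun := Sum.inr
  map_smul' _ _ := rfl

/-- The map out of a coproduct induced by maps out of the summands. -/
def sumDesc {X Y Z : Nom A} (f : X ⟶ Z) (g : Y ⟶ Z) : sum X Y ⟶ Z where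
  toFun := Sum.elim f.toFun g.toFun
  map_smul' := by
    rintro π (x | y)
    · exact hom_smul f π x
    · exact hom_smul g π y

theorem sumInl_sumDesc {X Y Z : Nom A} (f : X ⟶ Z) (g : Y ⟶ Z) :
    sumInl X Y ≫ sumDesc f g = f := rfl

theorem sumInr_sumDesc {X Y Z : Nom A} (f : X ⟶ Z) (g : Y ⟶ Z) :
    sumInr X Y ≫ sumDesc f g = g := rfl

theorem IsStrong.sum {X Y : Nom A} (hX : IsStrong X) (hY : IsStrong Y) :
    IsStrong (sum X Y) := by
  rintro (x | y) π hπ a ha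
  · exact hX x π (Sum.inl_injective hπ) a (supp_map_subset (sumInl X Y) x ha)
  · exact hY y π (Sum.inr_injective hπ) a (supp_map_subset (sumInr X Y) y ha)

/-- The part of a nominal set cut out by an invariant predicate. -/
def sub (X : Nom A) (p : X → Prop) (hp : ∀ (π : FinPerm A) x, p x → p (π • x)) : Nom A where
  carrier := {x : X // p x}
  action :=
    { smul := fun π x => ⟨π • x.1, hp π x.1 x.2⟩
      one_smul := fun x => Subtype.ext (one_smul _ x.1)
      mul_smul := fun π σ x => Subtype.ext (mul_smul π σ x.1) }
  finitely_supported := by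
    rintro ⟨x, hx⟩
    obtain ⟨s, hs, hsx⟩ := X.finitely_supported x
    exact ⟨s, hs, fun π hπ => Subtype.ext (hsx π hπ)⟩

theorem IsStrong.sub {X : Nom A} (hX : IsStrong X) (p : X → Prop)
    (hp : ∀ (π : FinPerm A) x, p x → p (π • x)) : IsStrong (sub X p hp) :=
  IsStrong.of_injective (X := Nom.sub X p hp) (Y := X)
    { toFun := Subtype.val, map_smul' := fun _ _ => rfl } Subtype.val_injective hX

/-- The element of `sub X p hp` given by an element of `X` satisfying `p`. -/
def sub.mk {X : Nom A} {p : X → Prop} {hp : ∀ (π : FinPerm A) x, p x → p (π • x)} (x : X)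
    (hx : p x) : sub X p hp := ⟨x, hx⟩

/-- The pointwise coproduct of two endofunctors. -/
def sumFunctor (F G : Nom A ⥤ Nom A) : Nom A ⥤ Nom A where
  obj X := sum (F.obj X) (G.obj X)
  map f := sumDesc (F.map f ≫ sumInl _ _) (G.map f ≫ sumInr _ _)
  map_id X := by
    apply hom_ext
    rintro (x | x)
    · exact congrArg Sum.inl (hom_congr (F.map_id X) x)
    · exact congrArg Sum.inr (hom_congr (G.map_id X) x)
  map_comp f g := by
    apply hom_ext
    rintro (x | x)
    · exact congrArg Sum.inl (hom_congr (F.map_comp f g) x)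
    · exact congrArg Sum.inr (hom_congr (G.map_comp f g) x)

theorem exists_eq_inl_smul {S X Y : Nom A} (f : S ⟶ sum X Y) (π : FinPerm A) (s : S) :
    (∃ x, f.toFun s = Sum.inl x) → ∃ x, f.toFun (π • s) = Sum.inl x := by
  rintro ⟨x, hx⟩
  exact ⟨π • x, by rw [hom_smul, hx]; rfl⟩

theorem exists_eq_inr_smul {S X Y : Nom A} (f : S ⟶ sum X Y) (π : FinPerm A) (s : S) :
    (∃ y, f.toFun s = Sum.inr y) → ∃ y, f.toFun (π • s) = Sum.inr y := by
  rintro ⟨y, hy⟩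
  exact ⟨π • y, by rw [hom_smul, hy]; rfl⟩

/-- The part of `S` that `f : S ⟶ X + Y` maps to the left summand. -/
def leftPart {S X Y : Nom A} (f : S ⟶ sum X Y) : Nom A :=
  sub S (fun s => ∃ x, f.toFun s = Sum.inl x) (exists_eq_inl_smul f)

/-- The part of `S` that `f : S ⟶ X + Y` maps to the right summand. -/
def rightPart {S X Y : Nom A} (f : S ⟶ sum X Y) : Nom A :=
  sub S (fun s => ∃ y, f.toFun s = Sum.inr y) (exists_eq_inr_smul f)

/-- A map `k : S ⟶ Z + W` taking the part of `S` cut out by `p` to the left summand restricts to a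
map from that part to `Z`. -/
theorem exists_left_lift {S Z W : Nom A} (k : S ⟶ sum Z W) (p : S → Prop)
    (hp : ∀ (π : FinPerm A) x, p x → p (π • x)) (hk : ∀ s, p s → ∃ z, k.toFun s = Sum.inl z) :
    ∃ k' : sub S p hp ⟶ Z, ∀ s (hs : p s), k.toFun s = Sum.inl (k'.toFun ⟨s, hs⟩) := by
  let R : sub S p hp → Z → Prop := fun s z => k.toFun s.1 = Sum.inl z
  have hR : ∀ (π : FinPerm A) s z, R s z → R (π • s) (π • z) := fun π s z h =>
    (hom_smul k π s.1).trans (congrArg (π • ·) h)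
  have hu : ∀ s, ∃! z, R s z := by
    rintro ⟨s, hs⟩
    obtain ⟨z, hz⟩ := hk s hs
    exact ⟨z, hz, fun z' hz' => Sum.inl_injective (hz'.symm.trans hz)⟩
  exact ⟨homOfExistsUnique R hR hu, fun s hs => homOfExistsUnique_spec R hR hu (sub.mk s hs)⟩

theorem exists_right_lift {S Z W : Nom A} (k : S ⟶ sum Z W) (p : S → Prop)
    (hp : ∀ (π : FinPerm A) x, p x → p (π • x)) (hk : ∀ s, p s → ∃ w, k.toFun s = Sum.inr w) :
    ∃ k' : sub S p hp ⟶ W, ∀ s (hs : p s), k.toFun s = Sum.inr (k'.toFun ⟨s, hs⟩) := by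
  let R : sub S p hp → W → Prop := fun s w => k.toFun s.1 = Sum.inr w
  have hR : ∀ (π : FinPerm A) s w, R s w → R (π • s) (π • w) := fun π s w h =>
    (hom_smul k π s.1).trans (congrArg (π • ·) h)
  have hu : ∀ s, ∃! w, R s w := by
    rintro ⟨s, hs⟩
    obtain ⟨w, hw⟩ := hk s hs
    exact ⟨w, hw, fun w' hw' => Sum.inr_injective (hw'.symm.trans hw)⟩
  exact ⟨homOfExistsUnique R hR hu, fun s hs => homOfExistsUnique_spec R hR hu (sub.mk s hs)⟩

/-- Maps on the two parts of `S` determined by `f` glue to a map on `S`. -/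
theorem exists_glue {S X Y Z : Nom A} (f : S ⟶ sum X Y) (k₁ : leftPart f ⟶ Z)
    (k₂ : rightPart f ⟶ Z) : ∃ k : S ⟶ Z,
      (∀ s hs, k.toFun s = k₁.toFun ⟨s, hs⟩) ∧ (∀ s hs, k.toFun s = k₂.toFun ⟨s, hs⟩) := by
  let R : S → Z → Prop := fun s z =>
    (∀ hs : ∃ x, f.toFun s = Sum.inl x, z = k₁.toFun ⟨s, hs⟩) ∧
      (∀ hs : ∃ y, f.toFun s = Sum.inr y, z = k₂.toFun ⟨s, hs⟩)
  have disj : ∀ s, (∃ x, f.toFun s = Sum.inl x) → (∃ y, f.toFun s = Sum.inr y) → False := by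
    rintro s ⟨x, hx⟩ ⟨y, hy⟩
    exact Sum.inl_ne_inr (hx.symm.trans hy)
  have cover : ∀ s, (∃ x, f.toFun s = Sum.inl x) ∨ (∃ y, f.toFun s = Sum.inr y) := by
    intro s
    rcases f.toFun s with x | y
    · exact .inl ⟨x, rfl⟩
    · exact .inr ⟨y, rfl⟩
  have hR : ∀ (π : FinPerm A) s z, R s z → R (π • s) (π • z) := by
    rintro π s z ⟨h₁, h₂⟩
    rcases cover s with hs | hs
    · refine ⟨fun _ => ?_, fun h => (disj _ (exists_eq_inl_smul f π s hs) h).elim⟩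
      rw [h₁ hs]
      exact (hom_smul k₁ π ⟨s, hs⟩).symm
    · refine ⟨fun h => (disj _ h (exists_eq_inr_smul f π s hs)).elim, fun _ => ?_⟩
      rw [h₂ hs]
      exact (hom_smul k₂ π ⟨s, hs⟩).symm
  have hu : ∀ s, ∃! z, R s z := by
    intro s
    rcases cover s with hs | hs
    · exact ⟨k₁.toFun ⟨s, hs⟩, ⟨fun _ => rfl, fun h => (disj s hs h).elim⟩, fun z hz => hz.1 hs⟩
    · exact ⟨k₂.toFun ⟨s, hs⟩, ⟨fun h => (disj s h hs).elim, fun _ => rfl⟩, fun z hz => hz.2 hs⟩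
  exact ⟨homOfExistsUnique R hR hu, fun s => (homOfExistsUnique_spec R hR hu s).1,
    fun s => (homOfExistsUnique_spec R hR hu s).2⟩

theorem admitsPreciseFactorizations_sum {F G : Nom A ⥤ Nom A}
    (hF : AdmitsPreciseFactorizations F IsStrong) (hG : AdmitsPreciseFactorizations G IsStrong) :
    AdmitsPreciseFactorizations (sumFunctor F G) IsStrong := by
  intro S Y f hS
  obtain ⟨f₁, hf₁⟩ := exists_left_lift f _ (exists_eq_inl_smul f) fun _ h => h
  obtain ⟨f₂, hf₂⟩ := exists_right_lift f _ (exists_eq_inr_smul f) fun _ h => h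
  obtain ⟨Y₁, hY₁, h₁, u₁, hu₁, e₁⟩ := hF f₁ (hS.sub _ _)
  obtain ⟨Y₂, hY₂, h₂, u₂, hu₂, e₂⟩ := hG f₂ (hS.sub _ _)
  obtain ⟨u, hul, hur⟩ := exists_glue (Z := (sumFunctor F G).obj (sum Y₁ Y₂)) f
    (u₁ ≫ F.map (sumInl Y₁ Y₂) ≫ sumInl _ _) (u₂ ≫ G.map (sumInr Y₁ Y₂) ≫ sumInr _ _)
  -- How `u` composes with `(F + G)d`, for `d` a map out of `Y₁ + Y₂`.
  have hul' : ∀ {Z : Nom A} (d : sum Y₁ Y₂ ⟶ Z) s hs,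
      (u ≫ (sumFunctor F G).map d).toFun s =
        Sum.inl ((u₁ ≫ F.map (sumInl Y₁ Y₂ ≫ d)).toFun ⟨s, hs⟩) := by
    intro Z d s hs
    rw [hom_comp_apply, hul s hs, F.map_comp]
    rfl
  have hur' : ∀ {Z : Nom A} (d : sum Y₁ Y₂ ⟶ Z) s hs,
      (u ≫ (sumFunctor F G).map d).toFun s =
        Sum.inr ((u₂ ≫ G.map (sumInr Y₁ Y₂ ≫ d)).toFun ⟨s, hs⟩) := by
    intro Z d s hs
    rw [hom_comp_apply, hur s hs, G.map_comp]
    rfl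
  refine ⟨sum Y₁ Y₂, hY₁.sum hY₂, sumDesc h₁ h₂, u, ?_, ?_⟩
  · intro X D k g h hsq
    -- The square forces `k` to respect the decomposition of `S` induced by `f`.
    have hkl : ∀ s, (∃ x, f.toFun s = Sum.inl x) → ∃ x, k.toFun s = Sum.inl x := by
      intro s hs
      have := (hul' g s hs).symm.trans (hom_congr hsq s)
      rw [hom_comp_apply] at this
      rcases hk : k.toFun s with x | x
      · exact ⟨x, rfl⟩
      · rw [hk] at this
        cases this
    have hkr : ∀ s, (∃ x, f.toFun s = Sum.inr x) → ∃ x, k.toFun s = Sum.inr x := by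
      intro s hs
      have := (hur' g s hs).symm.trans (hom_congr hsq s)
      rw [hom_comp_apply] at this
      rcases hk : k.toFun s with x | x
      · rw [hk] at this
        cases this
      · exact ⟨x, rfl⟩
    obtain ⟨k₁, hk₁⟩ := exists_left_lift k _ (exists_eq_inl_smul f) hkl
    obtain ⟨k₂, hk₂⟩ := exists_right_lift k _ (exists_eq_inr_smul f) hkr
    obtain ⟨d₁, hd₁, hd₁'⟩ := hu₁ k₁ (sumInl Y₁ Y₂ ≫ g) h (hom_ext fun ⟨s, hs⟩ => by
      have := (hul' g s hs).symm.trans (hom_congr hsq s)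
      rw [hom_comp_apply, hk₁ s hs] at this
      exact Sum.inl_injective this)
    obtain ⟨d₂, hd₂, hd₂'⟩ := hu₂ k₂ (sumInr Y₁ Y₂ ≫ g) h (hom_ext fun ⟨s, hs⟩ => by
      have := (hur' g s hs).symm.trans (hom_congr hsq s)
      rw [hom_comp_apply, hk₂ s hs] at this
      exact Sum.inr_injective this)
    refine ⟨sumDesc d₁ d₂, hom_ext fun s => ?_, hom_ext ?_⟩
    · rcases hfs : f.toFun s with x | x
      · rw [hul' _ s ⟨x, hfs⟩, sumInl_sumDesc, hd₁, hk₁ s ⟨x, hfs⟩]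
      · rw [hur' _ s ⟨x, hfs⟩, sumInr_sumDesc, hd₂, hk₂ s ⟨x, hfs⟩]
    · rintro (y | y)
      · exact hom_congr hd₁' y
      · exact hom_congr hd₂' y
  · refine hom_ext fun s => ?_
    rcases hfs : f.toFun s with x | x
    · rw [hul' _ s ⟨x, hfs⟩, sumInl_sumDesc, e₁, ← hf₁ s ⟨x, hfs⟩, hfs]
    · rw [hur' _ s ⟨x, hfs⟩, sumInr_sumDesc, e₂, ← hf₂ s ⟨x, hfs⟩, hfs]

/-! ### The constant functor and the product with the atoms -/

/-- The one-element nominal set `{✓}`. -/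
def unit (A : Type u) : Nom A where
  carrier := PUnit.{u + 1}
  finitely_supported _ := ⟨∅, Set.finite_empty, fun _ _ => rfl⟩

/-- The empty nominal set. -/
def empty (A : Type u) : Nom A where
  carrier := PEmpty.{u + 1}
  action :=
    { smul := fun _ x => x
      one_smul := fun _ => rfl
      mul_smul := fun _ _ _ => rfl }
  finitely_supported x := x.elim

/-- The unique map out of the empty nominal set. -/
def emptyDesc (X : Nom A) : empty A ⟶ X where
  toFun x := x.elim
  map_smul' _ x := x.elim

theorem admitsPreciseFactorizations_const (A : Type u) :
    AdmitsPreciseFactorizations ((Functor.const (Nom A)).obj (unit A)) IsStrong := by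
  intro S Y f _
  refine ⟨empty A, fun x => x.elim, emptyDesc Y, f, fun X D k g h _ => ?_, rfl⟩
  exact ⟨emptyDesc X, rfl, hom_ext fun x => x.elim⟩

/-- The functor `A × -`. -/
def prodAtoms (A : Type u) : Nom A ⥤ Nom A where
  obj X :=
    { carrier := A × X
      finitely_supported := by
        rintro ⟨a, x⟩
        obtain ⟨s, hs, hx⟩ := X.finitely_supported x
        exact ⟨insert a s, hs.insert a, fun π hπ => Prod.ext (hπ (Set.mem_insert a s))
          (hx π fun b hb => hπ (Set.mem_insert_of_mem a hb))⟩ }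
  map f :=
    { toFun := Prod.map id f.toFun
      map_smul' := fun π p => Prod.ext rfl (hom_smul f π p.2) }
  map_id _ := rfl
  map_comp _ _ := rfl

/-- The second projection `A × X ⟶ X`. -/
def prodSnd (X : Nom A) : (prodAtoms A).obj X ⟶ X where
  toFun := Prod.snd
  map_smul' _ _ := rfl

/-- The factorization of `f : S ⟶ A × Y` is through `s ↦ ((f s).1, s) : S ⟶ A × S`. -/
theorem admitsPreciseFactorizations_prodAtoms (A : Type u) :
    AdmitsPreciseFactorizations (prodAtoms A) IsStrong := by
  intro S Y f hS
  let u : S ⟶ (prodAtoms A).obj S :=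
    { toFun := fun s => ((f.toFun s).1, s)
      map_smul' := fun π s => by
        have h := congrArg (Prod.fst (α := A) (β := Y)) (hom_smul f π s)
        exact Prod.ext h rfl }
  refine ⟨S, hS, f ≫ prodSnd Y, u, fun X D k g h hsq => ?_, rfl⟩
  refine ⟨k ≫ prodSnd X, hom_ext fun s => Prod.ext ?_ rfl,
    hom_ext fun s => (congrArg Prod.snd (hom_congr hsq s)).symm⟩
  have h := congrArg (Prod.fst (α := A) (β := D)) (hom_congr hsq s)
  exact h

/-! ### Separated products and the binding functor -/

/-- The separated product `S * A` of a nominal set with the atoms: the pairs `(s, b)` with `b`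
fresh for `s`. -/
def separated (S : Nom A) : Nom A :=
  sub ((prodAtoms A).obj S) (fun p => p.1 ∉ supp A p.2) fun π _ hp => smul_notMem_supp π hp

theorem IsStrong.separated {S : Nom A} (hS : IsStrong S) : IsStrong (separated S) := by
  rintro ⟨⟨b, s⟩, hb⟩ π hπ a ha
  have hfix : π • ((b, s) : A × S) = (b, s) := congrArg Subtype.val hπ
  by_cases hab : a = b
  · rw [hab]
    exact congrArg Prod.fst hfix
  · refine hS s π (congrArg Prod.snd hfix) a fun t ht hts => ?_
    -- If `t` supports `s`, then `t ∪ {b}` supports `(s, b)`.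
    refine (ha (insert b t) (ht.insert b) fun σ hσ => Subtype.ext (Prod.ext ?_ ?_)).resolve_left hab
    · exact hσ (Set.mem_insert b t)
    · exact hts σ fun c hc => hσ (Set.mem_insert_of_mem b hc)

/-- The pair `(s, b)` as an element of `S * A`. -/
def separated.mk {S : Nom A} (s : S) (b : A) (hb : b ∉ supp A s) : separated S := ⟨(b, s), hb⟩

variable [Infinite A]

theorem exists_notMem_supp {X Y : Nom A} (x : X) (y : Y) :
    ∃ c : A, c ∉ supp A x ∧ c ∉ supp A y := by
  obtain ⟨c, hc⟩ := ((finite_supp X x).union (finite_supp Y y)).infinite_compl.nonempty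
  exact ⟨c, fun h => hc (.inl h), fun h => hc (.inr h)⟩

theorem Abstraction.mk_injective {X : Nom A} (b : A) :
    Function.Injective (Abstraction.mk (X := X) b) := by
  intro x y h
  obtain ⟨c, -, -, h⟩ := Quotient.exact (s := alphaSetoid X) h
  exact MulAction.injective _ h

/-- Renaming a bound atom to a fresh one. -/
theorem Abstraction.mk_eq_mk_swap {X : Nom A} (a c : A) (x : X) (hc : c ∉ supp A x) :
    Abstraction.mk a x = Abstraction.mk c (FinPerm.swap a c • x) := by
  obtain ⟨e, he, he'⟩ := exists_notMem_supp x (FinPerm.swap a c • x)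
  exact Quotient.sound (s := alphaSetoid X) ⟨e, he, he', (swap_smul_change hc he).symm⟩

/-- An atom fresh for an abstraction may be used as its bound atom. -/
theorem Abstraction.exists_mk_eq {X : Nom A} (q : (binding A).obj X) {b : A}
    (hb : b ∉ supp A q) : ∃ x : X, Abstraction.mk b x = q := by
  obtain ⟨⟨a, x⟩, rfl⟩ := Quotient.exists_rep (s := alphaSetoid X) q
  -- Rename to an atom `c` fresh for both `x` and `⟨a⟩x`; then `(c b)` fixes `⟨a⟩x`.
  obtain ⟨c, hcx, hcq⟩ := exists_notMem_supp (Y := (binding A).obj X) x (Abstraction.mk a x)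
  refine ⟨FinPerm.swap c b • FinPerm.swap a c • x, ?_⟩
  have h := swap_smul_of_notMem_supp hcq hb
  refine Eq.trans ?_ h
  conv_rhs => rw [Abstraction.mk_eq_mk_swap a c x hcx]
  refine Eq.trans ?_ (Abstraction.smul_mk (FinPerm.swap c b) c _).symm
  rw [FinPerm.swap_smul_left]

/-- The transpose `S * A ⟶ X` of `f : S ⟶ [A]X` sends `(s, b)` to the `x` with `f s = ⟨b⟩x`. -/
noncomputable def transpose {S X : Nom A} (f : S ⟶ (binding A).obj X) : separated S ⟶ X :=
  homOfExistsUnique (X := separated S)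
    (fun p x => (Abstraction.mk p.1.1 x : Abstraction X) = f.toFun p.1.2)
    (fun π p x h => by
      refine Eq.trans ?_ (hom_smul f π p.1.2).symm
      rw [← h]
      rfl)
    (by
      rintro ⟨⟨b, s⟩, hb⟩
      obtain ⟨x, hx⟩ := Abstraction.exists_mk_eq (f.toFun s) fun h => hb (supp_map_subset f s h)
      exact ⟨x, hx, fun y hy => Abstraction.mk_injective b (hy.trans hx.symm)⟩)

theorem mk_transpose {S X : Nom A} (f : S ⟶ (binding A).obj X) (s : S) (b : A)
    (hb : b ∉ supp A s) :
    Abstraction.mk b ((transpose f).toFun (separated.mk s b hb)) = f.toFun s :=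
  homOfExistsUnique_spec (X := separated S)
    (fun p x => (Abstraction.mk p.1.1 x : Abstraction X) = f.toFun p.1.2) _ _ (separated.mk s b hb)

/-- The unit `S ⟶ [A](S * A)`, `s ↦ ⟨b⟩(s, b)` for any `b` fresh for `s`. -/
theorem exists_separatedUnit (S : Nom A) : ∃ u : S ⟶ (binding A).obj (separated S),
    ∀ (s : S) (b : A) (hb : b ∉ supp A s),
      u.toFun s = Abstraction.mk b (separated.mk s b hb) := by
  let R : S → (binding A).obj (separated S) → Prop := fun s q =>
    ∀ (b : A) (hb : b ∉ supp A s), q = Abstraction.mk b (separated.mk s b hb)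
  have hR : ∀ (π : FinPerm A) s q, R s q → R (π • s) (π • q) := by
    intro π s q h b hb
    have hb' : π⁻¹ • b ∉ supp A s := by
      have := smul_notMem_supp π⁻¹ hb
      rwa [inv_smul_smul] at this
    rw [h _ hb']
    refine (Abstraction.smul_mk (X := separated S) π _ _).trans ?_
    have : π • separated.mk s (π⁻¹ • b) hb' = separated.mk (π • s) b hb :=
      Subtype.ext (Prod.ext (smul_inv_smul π b) rfl)
    rw [this, smul_inv_smul]
  have hu : ∀ s, ∃! q, R s q := by
    intro s
    obtain ⟨c, hc⟩ := (finite_supp S s).infinite_compl.nonempty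
    refine ⟨Abstraction.mk c (separated.mk s c hc), fun b hb => ?_, fun q hq => hq c hc⟩
    by_cases hbc : b = c
    · subst hbc
      rfl
    -- If `t` supports `s` and omits `b`, then `t ∪ {c}` supports `(s, c)` and omits `b`.
    have hb' : b ∉ supp A (separated.mk s c hc) := by
      obtain ⟨t, ht, hts, hbt⟩ := notMem_supp.1 hb
      refine notMem_supp.2 ⟨insert c t, ht.insert c, fun σ hσ => Subtype.ext (Prod.ext ?_ ?_), ?_⟩
      · exact hσ (Set.mem_insert c t)
      · exact hts σ fun d hd => hσ (Set.mem_insert_of_mem c hd)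
      · rintro (h | h)
        exacts [hbc h, hbt h]
    rw [Abstraction.mk_eq_mk_swap (X := separated S) c b _ hb']
    refine congrArg (Abstraction.mk (X := separated S) b) (Subtype.ext (Prod.ext ?_ ?_))
    · exact FinPerm.swap_smul_left c b
    · exact swap_smul_of_notMem_supp hc hb
  exact ⟨homOfExistsUnique R hR hu, homOfExistsUnique_spec R hR hu⟩

theorem admitsPreciseFactorizations_binding (A : Type u) [Infinite A] :
    AdmitsPreciseFactorizations (binding A) IsStrong := by
  intro S Y f hS
  obtain ⟨u, hu⟩ := exists_separatedUnit S
  have fac : ∀ {X : Nom A} (k : S ⟶ (binding A).obj X), u ≫ (binding A).map (transpose k) = k := by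
    intro X k
    refine hom_ext fun s => ?_
    obtain ⟨b, hb⟩ := (finite_supp S s).infinite_compl.nonempty
    rw [hom_comp_apply, hu s b hb]
    exact mk_transpose k s b hb
  refine ⟨separated S, hS.separated, transpose f, u, fun X D k g h hsq => ?_, fac f⟩
  refine ⟨transpose k, fac k, hom_ext ?_⟩
  -- Abstracting `b` in either side gives the same element of `[A]D`, by the square at `s`.
  rintro ⟨⟨b, s⟩, hb⟩
  have := hom_congr hsq s
  rw [hom_comp_apply, hom_comp_apply, hu s b hb, ← mk_transpose k s b hb] at this
  exact (Abstraction.mk_injective b this).symm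

theorem admitsPreciseFactorizations_rnnaFunctor (A : Type u) [Infinite A] :
    AdmitsPreciseFactorizations (rnnaFunctor A) IsStrong := by
  have h : rnnaFunctor A = sumFunctor ((Functor.const (Nom A)).obj (unit A))
      (sumFunctor (binding A) (prodAtoms A)) := by
    refine CategoryTheory.Functor.ext (fun _ => rfl) fun X Y f => hom_ext ?_
    rintro (x | q | p) <;> rfl
  rw [h]
  exact admitsPreciseFactorizations_sum (admitsPreciseFactorizations_const A)
    (admitsPreciseFactorizations_sum (admitsPreciseFactorizations_binding A)
      (admitsPreciseFactorizations_prodAtoms A))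

end Nom

theorem proposition4p9 (A : Type u) [Countable A] [Infinite A] :
    AdmitsPreciseFactorizations (Nom.binding A) Nom.IsStrong ∧
      AdmitsPreciseFactorizations (Nom.rnnaFunctor A) Nom.IsStrong :=
  ⟨Nom.admitsPreciseFactorizations_binding A, Nom.admitsPreciseFactorizations_rnnaFunctor A⟩
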